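/- All graphs are finite, simple, undirected, with nonempty vertex set. A clique transversal of a graph $G=(V,E)$ is a set $X\subseteq V$ that intersects every (inclusion-)maximal clique of $G$; it is minimal if it contains no other clique transversal. The upper clique transversal number $\tau_c^+(G)$ is the maximum size of a minimal clique transversal of $G$. Theorem. For every integer $k\ge 2$ there is an algorithm that, given a graph $G=(V,E)$ by its sorted adjacency lists, decides in time $\mathcal{O}(|V|^{3k-3})$ whether $G$ has a minimal clique transversal of size at least $k$, i.e., whether $\tau_c^+(G)\ge k$. Here $k$ is fixed: the algorithm and the constant in the $\mathcal{O}$-notation may depend on $k$, but not on $G$. Time is the number of steps on a random access machine with words of $\mathcal{O}(\log(|V|+1))$ bits (the constant may depend on $k$), each elementary operation (assignment, memory access, addition, truncated subtraction, multiplication, comparison, test) taking one step. -/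

import Mathlib

/-! ## Clique transversals -/

namespace SimpleGraph

variable {V : Type*}

/-- A set of vertices meeting every (inclusion-)maximal clique of `G`. -/
def IsCliqueTransversal (G : SimpleGraph V) (X : Finset V) : Prop :=
  ∀ C : Set V, Maximal G.IsClique C → ∃ v ∈ X, v ∈ C

/-- A clique transversal that contains no other clique transversal. -/
def IsMinimalCliqueTransversal (G : SimpleGraph V) (X : Finset V) : Prop :=
  Minimal G.IsCliqueTransversal X

open Classical in
/-- The upper clique transversal number `τ_c⁺(G)`: the maximum size of a minimal clique
transversal of the finite graph `G`. -/
noncomputable def upperCliqueTransversalNumber [Fintype V] (G : SimpleGraph V) : ℕ :=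
  ({X : Finset V | G.IsMinimalCliqueTransversal X} : Finset (Finset V)).sup Finset.card

/-- For `k ≥ 1`, `τ_c⁺(G) ≥ k` iff `G` has a minimal clique transversal of size at least `k`. -/
theorem le_upperCliqueTransversalNumber_iff [Fintype V] (G : SimpleGraph V) {k : ℕ}
    (hk : 1 ≤ k) :
    k ≤ G.upperCliqueTransversalNumber ↔
      ∃ X : Finset V, G.IsMinimalCliqueTransversal X ∧ k ≤ X.card := by
  unfold upperCliqueTransversalNumber
  rw [Finset.le_sup_iff (show (⊥ : ℕ) < k from hk)]
  simp

end SimpleGraph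

/-! ## A random access machine with bounded words

Programs are structured programs over finitely many registers and an addressable memory.  All
registers and memory cells hold natural numbers smaller than `W`, the number of machine words.
Every elementary instruction and every test of a condition takes one unit of time. -/

namespace WordRAM

/-- The binary operations on words that take one unit of time. -/
inductive BinOp
  | add
  | sub
  | mul
  | eq
  | lt

/-- Subtraction is truncated at `0`; comparisons return `1` for true and `0` for false. -/
def BinOp.eval : BinOp → ℕ → ℕ → ℕ
  | .add, a, b => a + b
  | .sub, a, b => a - b
  | .mul, a, b => a * b
  | .eq, a, b => if a = b then 1 else 0
  | .lt, a, b => if a < b then 1 else 0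

/-- Programs.  Registers are named by natural numbers (a program mentions finitely many). -/
inductive Prog
  /-- do nothing -/
  | skip
  /-- `r x := c` -/
  | const (x c : ℕ)
  /-- `r x := r y` -/
  | copy (x y : ℕ)
  /-- `r x := o (r y) (r z)` -/
  | op (o : BinOp) (x y z : ℕ)
  /-- `r x := memory[r y]` -/
  | load (x y : ℕ)
  /-- `memory[r x] := r y` -/
  | store (x y : ℕ)
  /-- `p; q` -/
  | seq (p q : Prog)
  /-- if `r x ≠ 0` then `p` else `q` -/
  | ite (x : ℕ) (p q : Prog)
  /-- while `r x ≠ 0` do `p` -/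
  | loop (x : ℕ) (p : Prog)

/-- The contents of the registers and of the memory. -/
structure State where
  reg : ℕ → ℕ
  mem : ℕ → ℕ

/-- Write `v` into register `x`. -/
def State.setReg (s : State) (x v : ℕ) : State :=
  { s with reg := Function.update s.reg x v }

/-- Write `v` into memory cell `a`. -/
def State.setMem (s : State) (a v : ℕ) : State :=
  { s with mem := Function.update s.mem a v }

/-- `Exec W p s t s'`: started in state `s`, the program `p` halts after exactly `t` steps in
state `s'`, and no number computed on the way exceeds the word range `{0, …, W - 1}` (a program
that computes a larger number has no execution: an overflow is a failure). -/
inductive Exec (W : ℕ) : Prog → State → ℕ → State → Prop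
  | skip (s : State) : Exec W .skip s 1 s
  | const (x c : ℕ) (s : State) (h : c < W) : Exec W (.const x c) s 1 (s.setReg x c)
  | copy (x y : ℕ) (s : State) : Exec W (.copy x y) s 1 (s.setReg x (s.reg y))
  | op (o : BinOp) (x y z : ℕ) (s : State) (h : o.eval (s.reg y) (s.reg z) < W) :
      Exec W (.op o x y z) s 1 (s.setReg x (o.eval (s.reg y) (s.reg z)))
  | load (x y : ℕ) (s : State) : Exec W (.load x y) s 1 (s.setReg x (s.mem (s.reg y)))
  | store (x y : ℕ) (s : State) : Exec W (.store x y) s 1 (s.setMem (s.reg x) (s.reg y))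
  | seq {p q : Prog} {s s' s'' : State} {t t' : ℕ} (hp : Exec W p s t s')
      (hq : Exec W q s' t' s'') : Exec W (.seq p q) s (t + t') s''
  | ite_true {x : ℕ} {p q : Prog} {s s' : State} {t : ℕ} (hx : s.reg x ≠ 0)
      (hp : Exec W p s t s') : Exec W (.ite x p q) s (t + 1) s'
  | ite_false {x : ℕ} {p q : Prog} {s s' : State} {t : ℕ} (hx : s.reg x = 0)
      (hq : Exec W q s t s') : Exec W (.ite x p q) s (t + 1) s'
  | loop_stop {x : ℕ} {p : Prog} {s : State} (hx : s.reg x = 0) : Exec W (.loop x p) s 1 s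
  | loop_step {x : ℕ} {p : Prog} {s s' s'' : State} {t t' : ℕ} (hx : s.reg x ≠ 0)
      (hp : Exec W p s t s') (hl : Exec W (.loop x p) s' t' s'') :
      Exec W (.loop x p) s (t + t' + 1) s''

/-- The machine is deterministic: final state and running time are functions of the start. -/
theorem Exec.deterministic {W : ℕ} {p : Prog} {s s₁ s₂ : State} {t₁ t₂ : ℕ}
    (h₁ : Exec W p s t₁ s₁) (h₂ : Exec W p s t₂ s₂) : t₁ = t₂ ∧ s₁ = s₂ := by
  induction h₁ generalizing t₂ s₂ with
  | skip | const | copy | op | load | store => cases h₂; exact ⟨rfl, rfl⟩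
  | seq _ _ ihp ihq =>
    cases h₂ with
    | seq hp hq =>
      obtain ⟨rfl, rfl⟩ := ihp hp
      obtain ⟨rfl, rfl⟩ := ihq hq
      exact ⟨rfl, rfl⟩
  | ite_true hx _ ih =>
    cases h₂ with
    | ite_true _ hp => obtain ⟨rfl, rfl⟩ := ih hp; exact ⟨rfl, rfl⟩
    | ite_false hx' _ => exact absurd hx' hx
  | ite_false hx _ ih =>
    cases h₂ with
    | ite_true hx' _ => exact absurd hx hx'
    | ite_false _ hq => obtain ⟨rfl, rfl⟩ := ih hq; exact ⟨rfl, rfl⟩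
  | loop_stop hx =>
    cases h₂ with
    | loop_stop _ => exact ⟨rfl, rfl⟩
    | loop_step hx' _ _ => exact absurd hx hx'
  | loop_step hx _ _ ihp ihl =>
    cases h₂ with
    | loop_stop hx' => exact absurd hx' hx
    | loop_step _ hp hl =>
      obtain ⟨rfl, rfl⟩ := ihp hp
      obtain ⟨rfl, rfl⟩ := ihl hl
      exact ⟨rfl, rfl⟩

/-- All registers are `0`, the input is at the beginning of the memory, followed by zeros. -/
def State.init (input : List ℕ) : State where
  reg := fun _ => 0
  mem := fun i => input.getD i 0

/-- The number of words, `2 ^ w` with word length `w = c (⌊log₂ n⌋ + 1)` bits. -/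
def wordCount (c n : ℕ) : ℕ := 2 ^ (c * (Nat.log 2 n + 1))

end WordRAM

/-! ## Decision problems on graphs -/

open Classical in
/-- The sorted adjacency list of a vertex. -/
noncomputable def SimpleGraph.adjacencyList {n : ℕ} (G : SimpleGraph (Fin n)) (v : Fin n) :
    List ℕ :=
  ((List.finRange n).filter fun u => G.Adj v u).map Fin.val

/-- A graph on `{0, …, n - 1}` as machine input: the number `n`, followed by the sorted adjacency
lists of `0, …, n - 1`, each of them preceded by its length. -/
noncomputable def SimpleGraph.encode {n : ℕ} (G : SimpleGraph (Fin n)) : List ℕ :=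
  n :: (List.finRange n).flatMap fun v => (G.adjacencyList v).length :: G.adjacencyList v

/-- The graph problem `L` is solvable in time `O(f(|V|))`: some program, on some machine with words
of `O(log |V|)` bits, halts on every graph with `n ≥ 1` vertices after at most `C * f n` steps, and
register `0` is then nonzero exactly for the yes-instances. -/
def GraphProblemSolvableInTime (L : ∀ n : ℕ, SimpleGraph (Fin n) → Prop) (f : ℕ → ℕ) : Prop :=
  ∃ (P : WordRAM.Prog) (c C : ℕ), 0 < c ∧ ∀ n : ℕ, 1 ≤ n → ∀ G : SimpleGraph (Fin n),
    ∃ (t : ℕ) (s : WordRAM.State),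
      WordRAM.Exec (WordRAM.wordCount c n) P (WordRAM.State.init G.encode) t s ∧
      t ≤ C * f n ∧ (s.reg 0 ≠ 0 ↔ L n G)

/-- The `k`-Upper Clique Transversal problem: is `τ_c⁺(G) ≥ k`? -/
def KUpperCliqueTransversal (k : ℕ) (n : ℕ) (G : SimpleGraph (Fin n)) : Prop :=
  k ≤ G.upperCliqueTransversalNumber

/-! ### Characterization by clique transversals of bounded size -/

namespace SimpleGraph

variable {V : Type*} [Fintype V] {G : SimpleGraph V}

/-! Put `K = k - 1` and pass to complements: `τ_c⁺(G) > K` means that some set `T` contains no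
maximal clique but meets every clique transversal of at most `K` vertices (a "small" transversal).
Few vertices suffice to detect such a `T`. Shrink `T` to be inclusion-minimal among the sets meeting
all small transversals. If `T` is a clique, it lies properly in a maximal clique, so some `v` is
adjacent to all of `T`; then the neighbourhood of `v` meets all small transversals, and it never
contains a maximal clique. Otherwise `T` has nonadjacent `a ≠ b`, and minimality gives small
transversals `x ∋ a` and `z ∋ b` meeting `T` only there. Then every small transversal inside `x ∪ z`
contains `a` or `b`. Conversely, given such `x`, `z`, the set of `a`, `b` and everything outside `x
∪ z` works: a maximal clique inside it would meet `x` only in `a` and `z` only in `b`, hence contain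
both. This is `lt_upperCliqueTransversalNumber_iff`.

For the running time, failure of `K` vertices to be a transversal is witnessed by `K` further
vertices (`not_isCliqueTransversal_image_iff`), so a test costs `n ^ K`. Guessing `x` and `z` costs
`n ^ (2 * K)`, and the number of `K`-tuples drawn from them depends on `K` only; the total is `n ^
(3 * K)`. The case of `v` costs `n ^ (2 * K + 1)`. The closure properties of `Decides` turn these
formulas into machine programs. They run on an adjacency matrix, which is built in quadratic time.
-/

theorem IsClique.exists_maximal_ge {s : Set V} (hs : G.IsClique s) :
    ∃ C, s ⊆ C ∧ Maximal G.IsClique C :=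
  (Set.toFinite {C : Set V | G.IsClique C}).exists_le_maximal hs

/-- The vertices `x i` fail to form a clique transversal iff some clique contains for every `i` a
vertex that is neither equal nor adjacent to `x i`. -/
theorem not_isCliqueTransversal_image_iff [DecidableEq V] {ι : Type*} [Fintype ι] (x : ι → V) :
    ¬ G.IsCliqueTransversal (Finset.univ.image x) ↔
      ∃ y : ι → V, (∀ i j, y i = y j ∨ G.Adj (y i) (y j)) ∧
        ∀ i, y i ≠ x i ∧ ¬ G.Adj (y i) (x i) := by
  constructor
  · intro h
    simp only [IsCliqueTransversal, not_forall] at h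
    obtain ⟨C, hC, hxC⟩ := h
    simp only [Finset.mem_image, Finset.mem_univ, true_and, not_exists, not_and,
      forall_exists_index, forall_apply_eq_imp_iff] at hxC
    have key : ∀ i, ∃ y ∈ C, y ≠ x i ∧ ¬ G.Adj y (x i) := by
      intro i
      by_contra! hcon
      -- A vertex adjacent to all other vertices of a maximal clique belongs to it, but `C` avoids
      -- `x i`.
      have hins : G.IsClique (insert (x i) C) := by
        rw [isClique_insert]
        exact ⟨hC.prop, fun b hb hne => (hcon b hb hne.symm).symm⟩
      exact hxC i (hC.le_of_ge hins (Set.subset_insert _ _) (Set.mem_insert _ _))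
    choose y hyC hy using key
    exact ⟨y, fun i j => or_iff_not_imp_left.2 fun hne => hC.prop (hyC i) (hyC j) hne, hy⟩
  · rintro ⟨y, hclique, hy⟩ h
    have hr : G.IsClique (Set.range y) := by
      rintro _ ⟨i, rfl⟩ _ ⟨j, rfl⟩ hne
      exact (hclique i j).resolve_left hne
    obtain ⟨C, hyC, hC⟩ := hr.exists_maximal_ge
    obtain ⟨v, hv, hvC⟩ := h C hC
    obtain ⟨i, -, rfl⟩ := Finset.mem_image.1 hv
    exact (hy i).2 (hC.prop (hyC ⟨i, rfl⟩) hvC (hy i).1)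

/-- `τ_c⁺(G) > K` iff some clique transversal contains no clique transversal of size at most `K`,
expressed with the complement `T`. -/
theorem lt_upperCliqueTransversalNumber_iff_exists [DecidableEq V] [Nonempty V] {K : ℕ}
    (hK : 1 ≤ K) :
    K + 1 ≤ G.upperCliqueTransversalNumber ↔
      ∃ T : Set V, (∀ C, Maximal G.IsClique C → ¬ C ⊆ T) ∧
        ∀ x : Fin K → V, G.IsCliqueTransversal (Finset.univ.image x) → ∃ i, x i ∈ T := by
  classical
  rw [le_upperCliqueTransversalNumber_iff G (Nat.le_add_left 1 K)]
  constructor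
  · rintro ⟨X, hX, hcard⟩
    refine ⟨{v | v ∉ X}, fun C hC hCT => ?_, fun x hx => ?_⟩
    · obtain ⟨v, hv, hvC⟩ := hX.prop C hC
      exact hCT hvC hv
    · by_contra! hcon
      have hsub : Finset.univ.image x ⊆ X := by
        intro v hv
        obtain ⟨i, -, rfl⟩ := Finset.mem_image.1 hv
        simpa using hcon i
      have h1 := Finset.card_le_card (hX.le_of_le hx hsub)
      have h2 := (Finset.card_image_le (s := Finset.univ) (f := x))
      simp only [Finset.card_univ, Fintype.card_fin] at h2
      omega
  · rintro ⟨T, hT, hF⟩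
    have hX : G.IsCliqueTransversal (Finset.univ.filter (· ∉ T)) := by
      intro C hC
      obtain ⟨v, hvC, hvT⟩ := Set.not_subset.1 (hT C hC)
      exact ⟨v, by simpa using hvT, hvC⟩
    obtain ⟨X, hXT, hXmin⟩ :=
      (Set.toFinite {X : Finset V | G.IsCliqueTransversal X}).exists_le_minimal hX
    refine ⟨X, hXmin, ?_⟩
    by_contra! hlt
    -- For `K ≥ 1` the image of a `K`-tuple is nonempty, so `X` must be nonempty to be listed, with
    -- repetitions, as a tuple.
    have hne : X.Nonempty := by
      obtain ⟨C, -, hC⟩ := (isClique_empty (G := G)).exists_maximal_ge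
      obtain ⟨v, hv, -⟩ := hXmin.prop C hC
      exact ⟨v, hv⟩
    have : Nonempty X := hne.to_subtype
    have : NeZero K := ⟨by omega⟩
    obtain ⟨f, hf⟩ : ∃ f : Fin K → X, Function.Surjective f := by
      have hc : Fintype.card X ≤ Fintype.card (Fin K) := by simpa using Nat.lt_succ_iff.1 hlt
      obtain ⟨g⟩ := Function.Embedding.nonempty_of_card_le hc
      exact ⟨Function.invFun g, Function.invFun_surjective g.injective⟩
    have him : Finset.univ.image (fun i => (f i : V)) = X := by
      ext v
      simp only [Finset.mem_image, Finset.mem_univ, true_and]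
      constructor
      · rintro ⟨i, rfl⟩
        exact (f i).2
      · intro hv
        obtain ⟨i, hi⟩ := hf ⟨v, hv⟩
        exact ⟨i, by rw [hi]⟩
    obtain ⟨i, hi⟩ := hF (fun i => (f i : V)) (by rw [him]; exact hXmin.prop)
    simpa using (Finset.mem_filter.1 (hXT (f i).2)).2 hi

/-- A characterization of `τ_c⁺(G) > K` in terms of clique transversals of size at most `K`. -/
theorem lt_upperCliqueTransversalNumber_iff [DecidableEq V] [Nonempty V] {K : ℕ} (hK : 1 ≤ K) :
    K + 1 ≤ G.upperCliqueTransversalNumber ↔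
      (∃ v, ∀ x : Fin K → V, G.IsCliqueTransversal (Finset.univ.image x) →
        ∃ i, G.Adj v (x i)) ∨
      ∃ w : Fin K ⊕ Fin K → V,
        G.IsCliqueTransversal (Finset.univ.image fun i => w (.inl i)) ∧
        G.IsCliqueTransversal (Finset.univ.image fun i => w (.inr i)) ∧
        ∃ i j : Fin K, ¬ G.Adj (w (.inl i)) (w (.inr j)) ∧
          (∀ l, w (.inr l) ≠ w (.inl i)) ∧ (∀ l, w (.inl l) ≠ w (.inr j)) ∧
          ∀ e : Fin K → Fin K ⊕ Fin K,
            G.IsCliqueTransversal (Finset.univ.image fun l => w (e l)) →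
            ∃ l, w (e l) = w (.inl i) ∨ w (e l) = w (.inr j) := by
  rw [lt_upperCliqueTransversalNumber_iff_exists hK]
  constructor
  · rintro ⟨T₀, hT₀, hF₀⟩
    -- Shrinking keeps the property of containing no maximal clique, so only the hitting property
    -- has to be retained.
    obtain ⟨T, hTT₀, hTmin⟩ := (Set.toFinite {T : Set V | ∀ x : Fin K → V,
      G.IsCliqueTransversal (Finset.univ.image x) → ∃ i, x i ∈ T}).exists_le_minimal hF₀
    by_cases hTc : G.IsClique T
    · left
      obtain ⟨C, hTC, hC⟩ := hTc.exists_maximal_ge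
      obtain ⟨v, hvC, hvT⟩ := Set.not_subset.1 fun h => hT₀ C hC (h.trans hTT₀)
      refine ⟨v, fun x hx => ?_⟩
      obtain ⟨i, hi⟩ := hTmin.prop x hx
      exact ⟨i, hC.prop hvC (hTC hi) fun h => hvT (h ▸ hi)⟩
    · right
      have private_tuple : ∀ u ∈ T, ∃ x : Fin K → V,
          G.IsCliqueTransversal (Finset.univ.image x) ∧ (∃ i, x i = u) ∧
            ∀ i, x i ∈ T → x i = u := by
        intro u hu
        have hnot : ¬ ∀ x : Fin K → V,
            G.IsCliqueTransversal (Finset.univ.image x) → ∃ i, x i ∈ T \ {u} := fun h =>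
          (hTmin.le_of_le h Set.sdiff_subset hu).2 rfl
        push Not at hnot
        obtain ⟨x, hx, hxT⟩ := hnot
        have hu' : ∀ i, x i ∈ T → x i = u := fun i hi => by
          by_contra hne
          exact hxT i ⟨hi, hne⟩
        obtain ⟨i, hi⟩ := hTmin.prop x hx
        exact ⟨x, hx, ⟨i, hu' i hi⟩, hu'⟩
      simp only [IsClique, Set.Pairwise, not_forall] at hTc
      obtain ⟨a, ha, b, hb, hab, hadj⟩ := hTc
      obtain ⟨x, hx, ⟨i, rfl⟩, hxT⟩ := private_tuple a ha
      obtain ⟨z, hz, ⟨j, rfl⟩, hzT⟩ := private_tuple b hb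
      refine ⟨Sum.elim x z, hx, hz, i, j, hadj, fun l hl => ?_, fun l hl => ?_, fun e he => ?_⟩
      · simp only [Sum.elim_inl, Sum.elim_inr] at hl
        exact hab (hl ▸ hzT l (hl ▸ ha))
      · simp only [Sum.elim_inl, Sum.elim_inr] at hl
        exact hab (hl ▸ hxT l (hl ▸ hb)).symm
      · obtain ⟨l, hl⟩ := hTmin.prop _ he
        refine ⟨l, ?_⟩
        cases h : e l with
        | inl m =>
          left
          rw [h] at hl
          exact hxT m hl
        | inr m =>
          right
          rw [h] at hl
          exact hzT m hl
  · rintro (⟨v, hv⟩ | ⟨w, hx, hz, i, j, hadj, hzi, hxj, he⟩)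
    · refine ⟨{a | G.Adj v a}, fun C hC hCv => ?_, hv⟩
      have hins : G.IsClique (insert v C) := by
        rw [isClique_insert]
        exact ⟨hC.prop, fun b hb _ => hCv hb⟩
      exact G.loopless.irrefl v
        (hCv (hC.le_of_ge hins (Set.subset_insert _ _) (Set.mem_insert _ _)))
    -- The largest set that meets the guessed vertices only in the two distinguished ones.
    · refine ⟨{a | a = w (.inl i) ∨ a = w (.inr j) ∨ a ∉ Set.range w}, fun C hC hCT => ?_,
        fun f hf => ?_⟩
      · have hiC : w (.inl i) ∈ C := by
          obtain ⟨v, hvx, hvC⟩ := hx C hC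
          obtain ⟨l, -, rfl⟩ := Finset.mem_image.1 hvx
          rcases hCT hvC with h | h | h
          · exact h ▸ hvC
          · exact absurd h (hxj l)
          · exact absurd ⟨_, rfl⟩ h
        have hjC : w (.inr j) ∈ C := by
          obtain ⟨v, hvz, hvC⟩ := hz C hC
          obtain ⟨l, -, rfl⟩ := Finset.mem_image.1 hvz
          rcases hCT hvC with h | h | h
          · exact absurd h (hzi l)
          · exact h ▸ hvC
          · exact absurd ⟨_, rfl⟩ h
        exact hadj (hC.prop hiC hjC (hxj i))
      · by_contra! hcon
        -- A tuple avoiding this set lies in the range of `w`, so it has the form `w ∘ e` and the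
        -- finite check applies.
        have hrange : ∀ l, ∃ a, w a = f l := fun l => by
          have := hcon l
          simp only [Set.mem_ofPred_eq, not_or, not_not] at this
          exact this.2.2
        choose e hef using hrange
        have hfe : (fun l => w (e l)) = f := funext hef
        obtain ⟨l, hl⟩ := he e (by rw [hfe]; exact hf)
        have := hcon l
        simp only [Set.mem_ofPred_eq, not_or, ← hef l] at this
        exact hl.elim this.1 this.2.1

end SimpleGraph

/-! ## Relations decidable by nested loops over the vertices -/

namespace WordRAM

/-- The register that holds the `i`-th vertex variable. -/
abbrev varReg (i : ℕ) : ℕ := 6 + i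

/-- The address of the adjacency matrix in memory. -/
def matrixBase (n : ℕ) : ℕ := n * n + n + 1

/-- Register `2` holds `n`, register `3` the address of the adjacency matrix of `G`, and the
registers of the first `m` variables hold the values given by `ν`. -/
structure Ready {n : ℕ} (G : SimpleGraph (Fin n)) (m : ℕ) (ν : ℕ → Fin n) (s : State) : Prop where
  order : s.reg 2 = n
  base : s.reg 3 = matrixBase n
  matrix : ∀ u v : Fin n, s.mem (matrixBase n + u * n + v) ≠ 0 ↔ G.Adj u v
  var : ∀ i < m, s.reg (varReg i) = ν i

/-- Words are large enough for the addresses of the adjacency matrix. -/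
def LargeWords (n W : ℕ) : Prop := 3 * (n * n) + 2 * n + 4 ≤ W

/-- The relation `R` on the first `m` variables is decided in time `O(n ^ q)` by a program that
changes neither these variables nor the adjacency matrix; the answer appears in register `0`. -/
def Decides (m q : ℕ) (R : ∀ n : ℕ, SimpleGraph (Fin n) → (ℕ → Fin n) → Prop) : Prop :=
  ∃ (P : Prog) (C : ℕ), ∀ (n W : ℕ), LargeWords n W → ∀ (G : SimpleGraph (Fin n))
    (ν : ℕ → Fin n) (s : State), Ready G m ν s → ∃ (t : ℕ) (s' : State),
      Exec W P s t s' ∧ t ≤ C * n ^ q ∧ Ready G m ν s' ∧ (s'.reg 0 ≠ 0 ↔ R n G ν)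

/-- Registers other than those of the first `m` variables and `2`, `3` may be changed. -/
theorem Ready.of_agree {n m : ℕ} {G : SimpleGraph (Fin n)} {ν : ℕ → Fin n} {s s' : State}
    (h : Ready G m ν s) (hmem : s'.mem = s.mem)
    (hreg : ∀ r, r = 2 ∨ r = 3 ∨ (6 ≤ r ∧ r < 6 + m) → s'.reg r = s.reg r) : Ready G m ν s' where
  order := by rw [hreg 2 (by simp), h.order]
  base := by rw [hreg 3 (by simp), h.base]
  matrix := by rw [hmem]; exact h.matrix
  var i hi := by rw [hreg _ (by unfold varReg; omega), h.var i hi]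

theorem Ready.setReg {n m : ℕ} {G : SimpleGraph (Fin n)} {ν : ℕ → Fin n} {s : State}
    (h : Ready G m ν s) {r : ℕ} (hr : r ≠ 2 ∧ r ≠ 3 ∧ (r < 6 ∨ 6 + m ≤ r)) (v : ℕ) :
    Ready G m ν (s.setReg r v) :=
  h.of_agree rfl fun r' hr' => Function.update_of_ne (by omega) _ _

/-- Used to forget a variable once its quantifier has been processed, and to replace an assignment
by one that agrees on the live variables. -/
theorem Ready.mono {n m m' : ℕ} {G : SimpleGraph (Fin n)} {ν ν' : ℕ → Fin n} {s : State}
    (h : Ready G m' ν' s) (hm : m ≤ m') (hν : ∀ i < m, ν' i = ν i) : Ready G m ν s :=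
  ⟨h.order, h.base, h.matrix, fun i hi => by rw [h.var i (by omega), hν i hi]⟩

theorem State.setReg_reg_self (s : State) (x v : ℕ) : (s.setReg x v).reg x = v :=
  Function.update_self _ _ _

theorem State.setReg_reg_of_ne (s : State) {x y : ℕ} (v : ℕ) (h : y ≠ x) :
    (s.setReg x v).reg y = s.reg y :=
  Function.update_of_ne h _ _

/-! ### Closure under connectives and quantifiers -/

namespace Decides

variable {m q : ℕ} {R S : ∀ n : ℕ, SimpleGraph (Fin n) → (ℕ → Fin n) → Prop}

theorem congr (h : Decides m q R) (hRS : ∀ n G ν, R n G ν ↔ S n G ν) : Decides m q S := by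
  have : R = S := by
    funext n G ν
    exact propext (hRS n G ν)
  exact this ▸ h

theorem mono (h : Decides m q R) {q' : ℕ} (hq : q ≤ q') : Decides m q' R := by
  obtain ⟨P, C, hP⟩ := h
  refine ⟨P, C, fun n W hW G ν s hs => ?_⟩
  obtain ⟨t, s', he, ht, hs'⟩ := hP n W hW G ν s hs
  -- The value `ν 0` shows `0 < n`, without which powers of `n` need not be monotone in the
  -- exponent.
  exact ⟨t, s', he, ht.trans (Nat.mul_le_mul_left _
    (Nat.pow_le_pow_right (Fin.pos (ν 0)) hq)), hs'⟩

theorem true (m : ℕ) : Decides m 0 fun _ _ _ => True :=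
  ⟨.const 0 1, 1, fun n W hW G ν s hs => ⟨_, _, .const 0 1 s (by unfold LargeWords at hW; omega),
    by simp, hs.setReg (by omega) _, by simp [State.setReg_reg_self]⟩⟩

theorem equal {i j : ℕ} (hi : i < m) (hj : j < m) : Decides m 0 fun _ _ ν => ν i = ν j := by
  refine ⟨.op .eq 0 (varReg i) (varReg j), 1, fun n W hW G ν s hs => ⟨_, _, .op _ _ _ _ s ?_,
    by simp, hs.setReg (by omega) _, ?_⟩⟩
  · unfold LargeWords at hW
    unfold BinOp.eval
    dsimp only
    split <;> omega
  · rw [State.setReg_reg_self, hs.var i hi, hs.var j hj]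
    simp [BinOp.eval, Fin.ext_iff]

theorem adj {i j : ℕ} (hi : i < m) (hj : j < m) : Decides m 0 fun _ G ν => G.Adj (ν i) (ν j) := by
  refine ⟨.seq (.op .mul 4 (varReg i) 2) (.seq (.op .add 4 3 4)
    (.seq (.op .add 4 4 (varReg j)) (.load 0 4))), 4, fun n W hW G ν s hs => ?_⟩
  have hni : (ν i : ℕ) * n + n ≤ n * n := by
    have := Nat.mul_le_mul_right n (ν i).isLt
    rwa [Nat.succ_mul] at this
  have hnj := (ν j).isLt
  unfold LargeWords at hW
  have e1 : s.reg (varReg i) * s.reg 2 = ν i * n := by rw [hs.var i hi, hs.order]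
  have hs1 : Ready G m ν (s.setReg 4 (ν i * n)) := hs.setReg (by omega) _
  have hs2 : Ready G m ν ((s.setReg 4 (ν i * n)).setReg 4 (matrixBase n + ν i * n)) :=
    hs1.setReg (by omega) _
  have hs3 : Ready G m ν (((s.setReg 4 (ν i * n)).setReg 4 (matrixBase n + ν i * n)).setReg 4
    (matrixBase n + ν i * n + ν j)) := hs2.setReg (by omega) _
  have x1 : Exec W (.op .mul 4 (varReg i) 2) s 1 (s.setReg 4 (ν i * n)) := by
    rw [← e1]
    exact .op .mul _ _ _ s (by simp only [BinOp.eval]; rw [e1]; omega)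
  have x2 := Exec.op (W := W) .add 4 3 4 (s.setReg 4 (ν i * n)) (by
    simp only [BinOp.eval]
    rw [hs1.base, State.setReg_reg_self, matrixBase]; omega)
  simp only [BinOp.eval] at x2
  rw [hs1.base, State.setReg_reg_self] at x2
  have x3 := Exec.op (W := W) .add 4 4 (varReg j) ((s.setReg 4 (ν i * n)).setReg 4
    (matrixBase n + ν i * n)) (by
      simp only [BinOp.eval]
      rw [hs2.var j hj, State.setReg_reg_self, matrixBase]; omega)
  simp only [BinOp.eval] at x3
  rw [hs2.var j hj, State.setReg_reg_self] at x3
  refine ⟨_, _, .seq x1 (.seq x2 (.seq x3 (.load 0 4 _))), by simp, hs3.setReg (by omega) _, ?_⟩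
  rw [State.setReg_reg_self, State.setReg_reg_self]
  exact hs3.matrix _ _

theorem not (h : Decides m q R) : Decides m q fun n G ν => ¬ R n G ν := by
  obtain ⟨P, C, hP⟩ := h
  refine ⟨.seq P (.ite 0 (.const 0 0) (.const 0 1)), C + 2, fun n W hW G ν s hs => ?_⟩
  obtain ⟨t, s', he, ht, hs', hr⟩ := hP n W hW G ν s hs
  have hpos : 1 ≤ n ^ q := Nat.one_le_pow _ _ (Fin.pos (ν 0))
  have htime : t + (1 + 1) ≤ (C + 2) * n ^ q := by rw [add_mul]; omega
  unfold LargeWords at hW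
  by_cases h0 : s'.reg 0 = 0
  · refine ⟨_, _, .seq he (.ite_false h0 (.const _ _ _ (by omega))), htime,
      hs'.setReg (by omega) _, ?_⟩
    simp [State.setReg_reg_self, ← hr, h0]
  · refine ⟨_, _, .seq he (.ite_true h0 (.const _ _ _ (by omega))), htime,
      hs'.setReg (by omega) _, ?_⟩
    simp [State.setReg_reg_self, ← hr, h0]

theorem and (hR : Decides m q R) (hS : Decides m q S) :
    Decides m q fun n G ν => R n G ν ∧ S n G ν := by
  obtain ⟨P, C, hP⟩ := hR
  obtain ⟨Q, D, hQ⟩ := hS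
  refine ⟨.seq P (.ite 0 Q .skip), C + D + 2, fun n W hW G ν s hs => ?_⟩
  obtain ⟨t, s', he, ht, hs', hr⟩ := hP n W hW G ν s hs
  obtain ⟨t₂, s₂, he₂, ht₂, hs₂, hr₂⟩ := hQ n W hW G ν s' hs'
  have hpos : 1 ≤ n ^ q := Nat.one_le_pow _ _ (Fin.pos (ν 0))
  by_cases h0 : s'.reg 0 = 0
  · refine ⟨_, _, .seq he (.ite_false h0 (.skip _)), by rw [add_mul, add_mul]; omega, hs', ?_⟩
    simp [← hr, h0]
  · refine ⟨_, _, .seq he (.ite_true h0 he₂), by rw [add_mul, add_mul]; omega, hs₂, ?_⟩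
    simp [← hr, hr₂, h0]

theorem or (hR : Decides m q R) (hS : Decides m q S) :
    Decides m q fun n G ν => R n G ν ∨ S n G ν :=
  (hR.not.and hS.not).not.congr fun _ _ _ => by tauto

theorem imp (hR : Decides m q R) (hS : Decides m q S) :
    Decides m q fun n G ν => R n G ν → S n G ν :=
  (hR.not.or hS).congr fun _ _ _ => by tauto

/-- The index type is independent of `n`, so running the tests one after another only enlarges the
constant. -/
theorem forall_finite {ι : Type*} [Finite ι]
    {R : ι → ∀ n : ℕ, SimpleGraph (Fin n) → (ℕ → Fin n) → Prop} (h : ∀ i, Decides m q (R i)) :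
    Decides m q fun n G ν => ∀ i, R i n G ν := by
  classical
  have := Fintype.ofFinite ι
  suffices hs : ∀ A : Finset ι, Decides m q fun n G ν => ∀ i ∈ A, R i n G ν from
    (hs Finset.univ).congr fun _ _ _ => by simp
  intro A
  induction A using Finset.induction_on with
  | empty => exact ((true m).mono (Nat.zero_le q)).congr fun _ _ _ => by simp
  | insert a A _ ih => exact ((h a).and ih).congr fun _ _ _ => by simp

theorem exists_finite {ι : Type*} [Finite ι]
    {R : ι → ∀ n : ℕ, SimpleGraph (Fin n) → (ℕ → Fin n) → Prop} (h : ∀ i, Decides m q (R i)) :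
    Decides m q fun n G ν => ∃ i, R i n G ν :=
  (forall_finite fun i => (h i).not).not.congr fun _ _ _ => by simp

/-- Quantification over a vertex costs a factor `n`. -/
theorem exists_vertex (h : Decides (m + 1) q R) :
    Decides m (q + 1) fun n G ν => ∃ a, R n G (Function.update ν m a) := by
  obtain ⟨P, C, hP⟩ := h
  -- The variable register counts down from `n`. Register `1` controls the loop but may be
  -- overwritten by `P`, so it is restored from the variable register after a failure and cleared
  -- after a success.
  refine ⟨.seq (.copy (varReg m) 2) (.seq (.copy 1 2) (.loop 1 (.seq (.const 4 1)
    (.seq (.op .sub (varReg m) (varReg m) 4) (.seq P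
      (.ite 0 (.const 1 0) (.copy 1 (varReg m)))))))), C + 8, fun n W hW G ν s hs => ?_⟩
  have hW' := hW
  unfold LargeWords at hW'
  have hn : 1 ≤ n := Fin.pos (ν 0)
  -- The candidates below `a` remain. The condition at `a = 0` says that the last test failed; at
  -- the start it is vacuous because `n ≥ 1`. One round costs `P` plus five steps.
  have search : ∀ a ≤ n, ∀ s : State, Ready G m ν s → s.reg (varReg m) = a → s.reg 1 = a →
      (a = 0 → s.reg 0 = 0) → ∃ t s', Exec W (.loop 1 (.seq (.const 4 1)
        (.seq (.op .sub (varReg m) (varReg m) 4) (.seq P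
          (.ite 0 (.const 1 0) (.copy 1 (varReg m))))))) s t s' ∧
        t ≤ a * (C * n ^ q + 5) + 1 ∧ Ready G m ν s' ∧
        (s'.reg 0 ≠ 0 ↔ ∃ b : Fin n, (b : ℕ) < a ∧ R n G (Function.update ν m b)) := by
    intro a
    induction a with
    | zero =>
      intro _ s hs _ h1 h0
      exact ⟨_, _, Exec.loop_stop h1, by simp, hs, by simp [h0 rfl]⟩
    | succ a ih =>
      intro ha s hs hv h1 _
      let b : Fin n := ⟨a, ha⟩
      have x1 := Exec.const (W := W) 4 1 s (by omega)
      have e : (BinOp.sub).eval ((s.setReg 4 1).reg (varReg m)) ((s.setReg 4 1).reg 4) = a := by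
        rw [State.setReg_reg_self, State.setReg_reg_of_ne _ _ (by unfold varReg; omega), hv]
        rfl
      have x2 := Exec.op (W := W) .sub (varReg m) (varReg m) 4 (s.setReg 4 1) (by rw [e]; nlinarith)
      rw [e] at x2
      have hs1 : Ready G m ν ((s.setReg 4 1).setReg (varReg m) a) :=
        (hs.setReg (by omega) _).setReg (by unfold varReg; omega) _
      have hs2 : Ready G (m + 1) (Function.update ν m b) ((s.setReg 4 1).setReg (varReg m) a) := by
        refine ⟨hs1.order, hs1.base, hs1.matrix, fun i hi => ?_⟩
        rcases Nat.lt_succ_iff_lt_or_eq.1 hi with hi | rfl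
        · rw [hs1.var i hi, Function.update_of_ne (by omega)]
        · rw [State.setReg_reg_self, Function.update_self]
      obtain ⟨t, s', x3, ht, hs', hr⟩ := hP n W hW G _ _ hs2
      have hs'm : Ready G m ν s' := hs'.mono (Nat.le_succ m) fun i hi =>
        Function.update_of_ne (by omega) _ _
      have hvar : s'.reg (varReg m) = a := by
        rw [hs'.var m (Nat.lt_succ_self m), Function.update_self]
      have hne : s.reg 1 ≠ 0 := by omega
      by_cases h0 : s'.reg 0 = 0
      · have hs3 : Ready G m ν (s'.setReg 1 (s'.reg (varReg m))) := hs'm.setReg (by omega) _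
        obtain ⟨t₂, s₂, x₂, ht₂, hs₂, hr₂⟩ := ih (by omega) _ hs3
          (by rw [State.setReg_reg_of_ne _ _ (by unfold varReg; omega), hvar])
          (by rw [State.setReg_reg_self, hvar])
          (fun _ => by rw [State.setReg_reg_of_ne _ _ (by omega), h0])
        refine ⟨_, _, .loop_step hne (.seq x1 (.seq x2 (.seq x3 (.ite_false h0 (.copy _ _ _)))))
          x₂, by rw [Nat.succ_mul]; omega, hs₂, ?_⟩
        rw [hr₂]
        constructor
        · rintro ⟨c, hc, hR⟩
          exact ⟨c, by omega, hR⟩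
        · rintro ⟨c, hc, hR⟩
          rcases Nat.lt_succ_iff_lt_or_eq.1 hc with hc | hc
          · exact ⟨c, hc, hR⟩
          · obtain rfl : c = b := Fin.ext hc
            exact absurd h0 (hr.2 hR)
      · refine ⟨_, _, .loop_step hne (.seq x1 (.seq x2 (.seq x3 (.ite_true h0
          (.const 1 0 _ (by omega)))))) (Exec.loop_stop (State.setReg_reg_self _ _ _)),
          by rw [Nat.succ_mul]; omega, hs'm.setReg (by omega) _, ?_⟩
        rw [State.setReg_reg_of_ne _ _ (by omega)]
        exact ⟨fun _ => ⟨b, Nat.lt_succ_self a, hr.1 h0⟩, fun _ => h0⟩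
  have hs1 : Ready G m ν ((s.setReg (varReg m) (s.reg 2)).setReg 1
      ((s.setReg (varReg m) (s.reg 2)).reg 2)) :=
    (hs.setReg (by unfold varReg; omega) _).setReg (by omega) _
  have e2 : (s.setReg (varReg m) (s.reg 2)).reg 2 = n := by
    rw [State.setReg_reg_of_ne _ _ (by unfold varReg; omega), hs.order]
  obtain ⟨t, s', x, ht, hs', hr⟩ := search n le_rfl _ hs1
    (by rw [State.setReg_reg_of_ne _ _ (by unfold varReg; omega), State.setReg_reg_self, hs.order])
    (by rw [State.setReg_reg_self, e2]) (by omega)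
  refine ⟨_, _, .seq (.copy _ _ _) (.seq (.copy _ _ _) x), ?_, hs', ?_⟩
  · have hpos : 1 ≤ n ^ q := Nat.one_le_pow _ _ hn
    have : n ≤ n ^ q * n := Nat.le_mul_of_pos_left n hpos
    calc 1 + (1 + t) ≤ n * (C * n ^ q + 5) + 3 := by omega
      _ = C * (n ^ q * n) + 5 * n + 3 := by ring
      _ ≤ C * (n ^ q * n) + 8 * (n ^ q * n) := by omega
      _ = (C + 8) * n ^ (q + 1) := by ring
  · rw [hr]
    exact ⟨fun ⟨b, _, hb⟩ => ⟨b, hb⟩, fun ⟨b, hb⟩ => ⟨b, b.isLt, hb⟩⟩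

/-- The answer depends on the first `m` variables only. -/
theorem agree (h : Decides m q R) {n : ℕ} (G : SimpleGraph (Fin n)) {ν ν' : ℕ → Fin n}
    (hν : ∀ i < m, ν i = ν' i) (hR : R n G ν) : R n G ν' := by
  classical
  obtain ⟨P, C, hP⟩ := h
  -- A start state is constructed that is ready for both `ν` and `ν'`; determinism of the machine
  -- then forces equal answers.
  let M : ℕ → ℕ := fun a =>
    if ∃ u v : Fin n, a = matrixBase n + u * n + v ∧ G.Adj u v then 1 else 0
  have hM : ∀ u v : Fin n, M (matrixBase n + u * n + v) ≠ 0 ↔ G.Adj u v := by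
    intro u v
    simp only [M, ne_eq, ite_eq_right_iff, one_ne_zero, imp_false, not_not]
    constructor
    · rintro ⟨u', v', he, hadj⟩
      have he' : (v : ℕ) + n * u = v' + n * u' := by
        rw [mul_comm n, mul_comm n]; omega
      have hv : (v : ℕ) = v' := by
        simpa [Nat.add_mul_mod_self_left, Nat.mod_eq_of_lt] using congrArg (· % n) he'
      have hu : (u : ℕ) = u' := by
        have : n * (u : ℕ) = n * u' := by omega
        exact Nat.eq_of_mul_eq_mul_left (Fin.pos u) this
      rwa [Fin.ext hu, Fin.ext hv]
    · exact fun hadj => ⟨u, v, rfl, hadj⟩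
  let s : State := ⟨fun r => if r = 2 then n else if r = 3 then matrixBase n else ν (r - 6), M⟩
  have hs : Ready G m ν s := ⟨rfl, rfl, hM, fun i _ => by
    simp only [s, varReg]
    rw [if_neg (by omega), if_neg (by omega), Nat.add_sub_cancel_left]⟩
  obtain ⟨t, s₁, x₁, -, -, hr₁⟩ := hP n _ le_rfl G ν s hs
  obtain ⟨t', s₂, x₂, -, -, hr₂⟩ := hP n _ le_rfl G ν' s (hs.mono le_rfl hν)
  obtain ⟨-, rfl⟩ := x₁.deterministic x₂
  exact hr₂.1 (hr₁.2 hR)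

/-- Quantification over `r` vertices costs a factor `n ^ r`. -/
theorem exists_vertices (r : ℕ) (h : Decides (m + r) q R) :
    Decides m (q + r) fun n G ν => ∃ ν' : ℕ → Fin n, (∀ i < m, ν' i = ν i) ∧ R n G ν' := by
  induction r generalizing q R with
  | zero => exact h.congr fun n G ν =>
      ⟨fun hR => ⟨ν, fun _ _ => rfl, hR⟩, fun ⟨ν', hν, hR⟩ => h.agree G hν hR⟩
  | succ r ih =>
    have h' : Decides (m + r + 1) q R := h
    refine ((ih h'.exists_vertex).congr fun n G ν => ?_).mono (by omega)
    constructor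
    · rintro ⟨ν', hν, a, hR⟩
      exact ⟨_, fun i hi => by rw [Function.update_of_ne (by omega), hν i hi], hR⟩
    · rintro ⟨ν', hν, hR⟩
      exact ⟨ν', hν, ν' (m + r), by rwa [Function.update_eq_self]⟩

end Decides

end WordRAM

/-! ## The adjacency matrix -/

namespace WordRAM

/-- Mark, in the row of the matrix that starts at address `r 7`, the entries of the list that
starts at address `r 4` and has length `r 6`. -/
def fillRow : Prog :=
  .loop 6 (.seq (.load 5 4) (.seq (.op .add 5 5 7) (.seq (.store 5 8)
    (.seq (.op .add 4 4 8) (.op .sub 6 6 8)))))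

/-- Mark the entries of `r 1` lists, each preceded by its length, that are stored from address
`r 4` on, in consecutive rows of length `r 2` of a matrix that starts at address `r 7`. -/
def fillRows : Prog :=
  .loop 1 (.seq (.load 6 4) (.seq (.op .add 4 4 8) (.seq fillRow
    (.seq (.op .add 7 7 2) (.op .sub 1 1 8)))))

/-- Replace the adjacency lists by an adjacency matrix. -/
def buildMatrix : Prog :=
  .seq (.load 2 0) (.seq (.const 8 1) (.seq (.op .mul 3 2 2) (.seq (.op .add 3 3 2)
    (.seq (.op .add 3 3 8) (.seq (.copy 7 3) (.seq (.copy 4 8) (.seq (.copy 1 2) fillRows)))))))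

/-- All writes go to addresses from `row` on and the list lies below `row`, so unread input is never
overwritten. Each entry costs five instructions and one loop test. -/
theorem exec_fillRow {n W row : ℕ} (hW : row + n ≤ W) (L : List ℕ) :
    ∀ (p : ℕ) (s : State), (∀ u ∈ L, u < n) → p + L.length ≤ row → row < W → s.reg 4 = p →
      s.reg 6 = L.length → s.reg 7 = row → s.reg 8 = 1 →
      (∀ i (h : i < L.length), s.mem (p + i) = L[i]) →
      ∃ t s', Exec W fillRow s t s' ∧ t ≤ 6 * L.length + 1 ∧ s'.reg 4 = p + L.length ∧
        (∀ r, r ≠ 4 → r ≠ 5 → r ≠ 6 → s'.reg r = s.reg r) ∧ (∀ a < row, s'.mem a = s.mem a) ∧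
        ∀ a, s'.mem a ≠ 0 ↔ s.mem a ≠ 0 ∨ ∃ u ∈ L, a = row + u := by
  induction L with
  | nil =>
    intro p s _ _ _ h4 h6 _ _ _
    exact ⟨_, _, Exec.loop_stop h6, by simp, by simpa using h4, by simp, by simp, by simp⟩
  | cons u L ih =>
    intro p s hL hp hrow h4 h6 h7 h8 hmem
    simp only [List.length_cons] at hp h6 ⊢
    have hu : u < n := hL u (by simp)
    have hm0 : s.mem p = u := hmem 0 (by simp)
    obtain ⟨s₁, x₁, r4, r6, hreg, hmem₁⟩ : ∃ s₁, Exec W (.seq (.load 5 4) (.seq (.op .add 5 5 7)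
        (.seq (.store 5 8) (.seq (.op .add 4 4 8) (.op .sub 6 6 8))))) s 5 s₁ ∧
        s₁.reg 4 = p + 1 ∧ s₁.reg 6 = L.length ∧
        (∀ r, r ≠ 4 → r ≠ 5 → r ≠ 6 → s₁.reg r = s.reg r) ∧
        s₁.mem = Function.update s.mem (row + u) 1 := by
      refine ⟨_, .seq (.load _ _ _) (.seq (.op _ _ _ _ _ ?_) (.seq (.store _ _ _)
        (.seq (.op _ _ _ _ _ ?_) (.op _ _ _ _ _ ?_)))), ?_, ?_, fun r h4' h5' h6' => ?_, ?_⟩ <;>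
        simp [State.setReg, State.setMem, BinOp.eval, *] <;> first | omega | rw [add_comm]
    obtain ⟨t, s', x, ht, r4', hreg', hlow, hmem'⟩ := ih (p + 1) s₁
      (fun v hv => hL v (by simp [hv])) (by omega) hrow r4 r6
      (by rw [hreg 7 (by omega) (by omega) (by omega), h7])
      (by rw [hreg 8 (by omega) (by omega) (by omega), h8]) (fun i hi => by
        have := hmem (i + 1) (by simpa using hi)
        rw [hmem₁, Function.update_of_ne (by omega), add_assoc, add_comm 1, this]
        simp)
    refine ⟨_, _, .loop_step (by omega) x₁ x, by omega, by omega,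
      fun r h4 h5 h6 => by rw [hreg' r h4 h5 h6, hreg r h4 h5 h6],
      fun a ha => by rw [hlow a ha, hmem₁, Function.update_of_ne (by omega)], fun a => ?_⟩
    rw [hmem', hmem₁]
    by_cases ha : a = row + u
    · simp [ha]
    · simp [ha]

/-- The concatenation of lists, each preceded by its length. -/
def concatRows (rows : List (List ℕ)) : List ℕ :=
  rows.flatMap fun L => L.length :: L

theorem concatRows_cons (L : List ℕ) (rows : List (List ℕ)) :
    concatRows (L :: rows) = L.length :: L ++ concatRows rows :=
  List.flatMap_cons

/-- Bounds the row counter by the input length, so that its value fits into a word. -/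
theorem length_le_length_concatRows (rows : List (List ℕ)) :
    rows.length ≤ (concatRows rows).length := by
  induction rows with
  | nil => simp
  | cons L rows ih =>
    rw [concatRows_cons, List.length_append, List.length_cons, List.length_cons]
    omega

/-- A list of length `ℓ` costs `6 * ℓ + 6` steps including overhead. Its stored length word pays for
the additional `6`, so the time is linear in the length of the encoding. -/
theorem exec_fillRows {n W : ℕ} (rows : List (List ℕ)) :
    ∀ (p row : ℕ) (s : State), row + (rows.length + 1) * n < W → (∀ L ∈ rows, ∀ u ∈ L, u < n) →
      p + (concatRows rows).length ≤ row → s.reg 1 = rows.length →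
      s.reg 2 = n → s.reg 4 = p → s.reg 7 = row → s.reg 8 = 1 →
      (∀ i (h : i < (concatRows rows).length),
        s.mem (p + i) = (concatRows rows)[i]) →
      ∃ t s', Exec W fillRows s t s' ∧
        t ≤ 6 * (concatRows rows).length + 1 ∧
        (∀ r, r = 2 ∨ r = 3 → s'.reg r = s.reg r) ∧
        ∀ a, s'.mem a ≠ 0 ↔ s.mem a ≠ 0 ∨
          ∃ i, ∃ h : i < rows.length, ∃ u ∈ rows[i], a = row + i * n + u := by
  induction rows with
  | nil =>
    intro p row s _ _ _ h1 _ _ _ _ _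
    exact ⟨_, _, Exec.loop_stop h1, by simp, by simp, by simp⟩
  | cons L rows ih =>
    intro p row s hW hlt hp h1 h2 h4 h7 h8 hmem
    simp only [List.length_cons, concatRows_cons, List.length_append] at hW hp h1 hmem ⊢
    have hW₁ : row + n + (rows.length + 1) * n < W := by
      rw [Nat.succ_mul (rows.length + 1)] at hW; omega
    have hm0 : s.mem p = L.length := hmem 0 (by omega)
    obtain ⟨s₁, x₁, r4, r6, hreg₁, hmem₁⟩ : ∃ s₁, (∀ {t s₂}, Exec W (.seq fillRow
        (.seq (.op .add 7 7 2) (.op .sub 1 1 8))) s₁ t s₂ → Exec W (.seq (.load 6 4)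
        (.seq (.op .add 4 4 8) (.seq fillRow (.seq (.op .add 7 7 2) (.op .sub 1 1 8))))) s
        (1 + (1 + t)) s₂) ∧ s₁.reg 4 = p + 1 ∧ s₁.reg 6 = L.length ∧
        (∀ r, r ≠ 4 → r ≠ 6 → s₁.reg r = s.reg r) ∧ s₁.mem = s.mem := by
      refine ⟨_, fun x => .seq (.load _ _ _) (.seq (.op _ _ _ _ _ ?_) x), ?_, ?_,
        fun r h4' h6' => ?_, ?_⟩ <;> (simp [State.setReg, BinOp.eval, *]; try omega)
    obtain ⟨t, s₂, x₂, ht, r4₂, hreg₂, hlow₂, hmem₂⟩ := exec_fillRow (n := n) (W := W) (row := row)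
      (by omega) L (p + 1) s₁ (hlt L (by simp)) (by omega) (by omega) r4 r6
      (by rw [hreg₁ 7 (by omega) (by omega), h7]) (by rw [hreg₁ 8 (by omega) (by omega), h8])
      (fun i hi => by
        have := hmem (i + 1) (by omega)
        rw [hmem₁, add_assoc, add_comm 1, this]
        simp [List.getElem_append_left, hi])
    have g1 : s₂.reg 1 = rows.length + 1 := by
      rw [hreg₂ 1 (by omega) (by omega) (by omega), hreg₁ 1 (by omega) (by omega), h1]
    have g2 : s₂.reg 2 = n := by
      rw [hreg₂ 2 (by omega) (by omega) (by omega), hreg₁ 2 (by omega) (by omega), h2]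
    have g3 : s₂.reg 3 = s.reg 3 := by
      rw [hreg₂ 3 (by omega) (by omega) (by omega), hreg₁ 3 (by omega) (by omega)]
    have g7 : s₂.reg 7 = row := by
      rw [hreg₂ 7 (by omega) (by omega) (by omega), hreg₁ 7 (by omega) (by omega), h7]
    have g8 : s₂.reg 8 = 1 := by
      rw [hreg₂ 8 (by omega) (by omega) (by omega), hreg₁ 8 (by omega) (by omega), h8]
    have hlen := length_le_length_concatRows rows
    obtain ⟨s₃, x₃, k1, k2, k3, k4, k7, k8, kmem⟩ : ∃ s₃, Exec W (.seq (.op .add 7 7 2)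
        (.op .sub 1 1 8)) s₂ 2 s₃ ∧ s₃.reg 1 = rows.length ∧ s₃.reg 2 = n ∧
        s₃.reg 3 = s.reg 3 ∧ s₃.reg 4 = p + 1 + L.length ∧ s₃.reg 7 = row + n ∧
        s₃.reg 8 = 1 ∧ s₃.mem = s₂.mem := by
      refine ⟨_, .seq (.op _ _ _ _ _ ?_) (.op _ _ _ _ _ ?_), ?_, ?_, ?_, ?_, ?_, ?_, ?_⟩ <;>
        simp [State.setReg, BinOp.eval, g1, g2, g3, g7, g8, r4₂] <;> omega
    obtain ⟨t', s', x', ht', hreg', hmem'⟩ := ih (p + 1 + L.length) (row + n) s₃ hW₁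
      (fun M hM => hlt M (by simp [hM])) (by omega)
      k1 k2 k4 k7 k8 (fun i hi => by
        have := hmem (L.length + 1 + i) (by omega)
        rw [kmem, hlow₂ _ (by omega), hmem₁,
          show p + 1 + L.length + i = p + (L.length + 1 + i) by omega, this,
          List.getElem_append_right (by simp)]
        simp)
    refine ⟨_, _, .loop_step (by omega) (x₁ (.seq x₂ x₃)) x',
      by omega, ?_, fun a => ?_⟩
    · rintro r (rfl | rfl)
      · rw [hreg' 2 (.inl rfl), k2, h2]
      · rw [hreg' 3 (.inr rfl), k3]
    · rw [hmem', kmem, hmem₂, hmem₁, or_assoc]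
      refine or_congr_right ⟨?_, ?_⟩
      · rintro (⟨u, hu, rfl⟩ | ⟨i, hi, u, hu, rfl⟩)
        · exact ⟨0, by simp, u, by simpa using hu, by simp⟩
        · exact ⟨i + 1, by simpa using hi, u, by simpa using hu, by ring⟩
      · rintro ⟨i, hi, u, hu, rfl⟩
        cases i with
        | zero => exact .inl ⟨u, by simpa using hu, by simp⟩
        | succ i => exact .inr ⟨i, by simpa using hi, u, by simpa using hu, by ring⟩

/-- The adjacency matrix is built in quadratic time. -/
theorem exec_buildMatrix {n W : ℕ} (hW : LargeWords n W) (G : SimpleGraph (Fin n))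
    (ν : ℕ → Fin n) : ∃ t s, Exec W buildMatrix (State.init G.encode) t s ∧ t ≤ 27 * n ^ 2 ∧
      Ready G 0 ν s := by
  classical
  have hn : 1 ≤ n := Fin.pos (ν 0)
  unfold LargeWords at hW
  set rows : List (List ℕ) := (List.finRange n).map G.adjacencyList with hrows
  have hencode : G.encode = n :: concatRows rows := by
    simp [SimpleGraph.encode, concatRows, hrows, List.flatMap_map]
  have hlen : rows.length = n := by simp [hrows]
  -- With the leading word `n`, the input ends no later than `matrixBase n`; hence the matrix area
  -- is initially zero.
  have hElen : (concatRows rows).length ≤ n * n + n := by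
    have h : ∀ L ∈ rows, L.length ≤ n := by
      intro L hL
      obtain ⟨v, -, rfl⟩ := List.mem_map.1 hL
      simpa [SimpleGraph.adjacencyList] using
        List.length_filter_le (fun u => decide (G.Adj v u)) (List.finRange n)
    rw [concatRows, List.length_flatMap]
    refine (List.sum_le_card_nsmul _ (n + 1) ?_).trans ?_
    · intro x hx
      obtain ⟨L, hL, rfl⟩ := List.mem_map.1 hx
      simpa using h L hL
    · rw [List.length_map, hlen, smul_eq_mul, mul_add, mul_one]
  have hinit : ∀ i, (State.init G.encode).mem i = (n :: concatRows rows).getD i 0 := fun i => by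
    rw [← hencode]; rfl
  obtain ⟨s₁, x₁, h1, h2, h3, h4, h7, h8, hmem⟩ : ∃ s₁, (∀ {t s'}, Exec W fillRows s₁ t s' →
      Exec W buildMatrix (State.init G.encode)
        (1 + (1 + (1 + (1 + (1 + (1 + (1 + (1 + t)))))))) s') ∧ s₁.reg 1 = n ∧ s₁.reg 2 = n ∧
      s₁.reg 3 = matrixBase n ∧ s₁.reg 4 = 1 ∧ s₁.reg 7 = matrixBase n ∧ s₁.reg 8 = 1 ∧
      s₁.mem = (State.init G.encode).mem := by
    have h0 : (State.init G.encode).reg = fun _ => 0 := rfl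
    have hm : (State.init G.encode).mem 0 = n := by rw [hinit]; rfl
    refine ⟨_, fun x => .seq (.load _ _ _) (.seq (.const _ _ _ ?_) (.seq (.op _ _ _ _ _ ?_)
      (.seq (.op _ _ _ _ _ ?_) (.seq (.op _ _ _ _ _ ?_) (.seq (.copy _ _ _)
      (.seq (.copy _ _ _) (.seq (.copy _ _ _) x))))))), ?_, ?_, ?_, ?_, ?_, ?_, ?_⟩ <;>
      first | omega | (simp [State.setReg, BinOp.eval, h0, hm, matrixBase] <;> omega)
  obtain ⟨t, s, x, ht, hreg, hmem'⟩ := exec_fillRows (n := n) (W := W) rows 1 (matrixBase n) s₁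
    (by rw [hlen, matrixBase, Nat.succ_mul]; omega)
    (fun L hL u hu => by
      obtain ⟨v, -, rfl⟩ := List.mem_map.1 hL
      obtain ⟨w, -, rfl⟩ := List.mem_map.1 hu
      exact w.isLt)
    (by rw [matrixBase]; omega) (by rw [h1, hlen]) h2 h4 h7 h8
    (fun i hi => by rw [hmem, hinit, add_comm 1]; simp [hi])
  refine ⟨_, s, x₁ x, by nlinarith, ⟨by rw [hreg 2 (.inl rfl), h2],
    by rw [hreg 3 (.inr rfl), h3], fun u v => ?_, fun i hi => absurd hi (Nat.not_lt_zero i)⟩⟩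
  have hzero : (State.init G.encode).mem (matrixBase n + u * n + v) = 0 := by
    rw [hinit, List.getD_eq_default]
    simp only [List.length_cons, matrixBase]
    omega
  rw [hmem', hmem, hzero]
  simp only [ne_eq, not_true_eq_false, false_or]
  constructor
  · rintro ⟨i, hi, a, ha, he⟩
    have hi' : i < n := hlen ▸ hi
    obtain ⟨w, hw, rfl⟩ : ∃ w : Fin n, G.Adj ⟨i, hi'⟩ w ∧ (w : ℕ) = a := by
      simpa [hrows, SimpleGraph.adjacencyList] using ha
    -- Row and column are recovered from the address by division with remainder by `n`.
    have := finProdFinEquiv.injective (a₁ := (u, v)) (a₂ := (⟨i, hi'⟩, w)) (Fin.ext (by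
      simp only [finProdFinEquiv_apply_val]
      rw [mul_comm n, mul_comm n]
      omega))
    rw [Prod.mk.injEq] at this
    rwa [this.1, this.2]
  · intro h
    exact ⟨u, by rw [hlen]; exact u.isLt, v, by
      simpa [hrows, SimpleGraph.adjacencyList] using ⟨v, h, rfl⟩,
      rfl⟩

/-- With `M = 2 ^ (Nat.log 2 n + 1)` one has `n < M` and `2 ≤ M`, so the quadratic bound is at most
`2 ^ 6 * M ^ 2 ≤ M ^ 8`. -/
theorem largeWords_wordCount (n : ℕ) : LargeWords n (wordCount 8 n) := by
  have h : n < 2 ^ (Nat.log 2 n + 1) := Nat.lt_pow_succ_log_self (by norm_num) n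
  have h2 : 2 ≤ 2 ^ (Nat.log 2 n + 1) := by
    rw [pow_succ]
    have := Nat.one_le_two_pow (n := Nat.log 2 n)
    omega
  unfold LargeWords wordCount
  rw [mul_comm 8, pow_mul]
  set M := 2 ^ (Nat.log 2 n + 1)
  have h6 : 2 ^ 6 ≤ M ^ 6 := Nat.pow_le_pow_left h2 6
  calc 3 * (n * n) + 2 * n + 4 ≤ 2 ^ 6 * M ^ 2 := by nlinarith
    _ ≤ M ^ 6 * M ^ 2 := Nat.mul_le_mul_right _ h6
    _ = M ^ 8 := by ring

/-- A graph property decided by nested loops is decided from the adjacency lists within the same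
time bound, provided this is at least quadratic. -/
theorem Decides.graphProblemSolvableInTime {q : ℕ} (hq : 2 ≤ q)
    {R : ∀ n : ℕ, SimpleGraph (Fin n) → (ℕ → Fin n) → Prop}
    (h : Decides 0 q R) {L : ∀ n : ℕ, SimpleGraph (Fin n) → Prop}
    (hL : ∀ n G ν, R n G ν ↔ L n G) : GraphProblemSolvableInTime L fun n => n ^ q := by
  obtain ⟨P, C, hP⟩ := h
  refine ⟨.seq buildMatrix P, 8, 27 + C, by norm_num, fun n hn G => ?_⟩
  have hW := largeWords_wordCount n
  let ν : ℕ → Fin n := fun _ => ⟨0, hn⟩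
  obtain ⟨t, s, x, ht, hs⟩ := exec_buildMatrix hW G ν
  obtain ⟨t', s', x', ht', -, hr⟩ := hP n _ hW G ν s hs
  refine ⟨_, _, .seq x x', ?_, hr.trans (hL n G ν)⟩
  have : n ^ 2 ≤ n ^ q := Nat.pow_le_pow_right hn hq
  change t + t' ≤ (27 + C) * n ^ q
  rw [add_mul]
  omega

end WordRAM

/-! ## The upper clique transversal number -/

namespace WordRAM

/-- Whether the vertices `ν (σ i)` form a clique transversal is decided by a search for `K`
vertices. -/
theorem decides_isCliqueTransversal {K m : ℕ} (σ : Fin K → ℕ) (hσ : ∀ i, σ i < m) :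
    Decides m K fun _ G ν => G.IsCliqueTransversal (Finset.univ.image fun i => ν (σ i)) := by
  have h : Decides (m + K) 0 fun n G ν =>
      (∀ i j : Fin K, ν (m + i) = ν (m + j) ∨ G.Adj (ν (m + i)) (ν (m + j))) ∧
        ∀ i : Fin K, ν (m + i) ≠ ν (σ i) ∧ ¬ G.Adj (ν (m + i)) (ν (σ i)) := by
    have hy : ∀ i : Fin K, m + (i : ℕ) < m + K := fun i => Nat.add_lt_add_left i.isLt m
    have hx : ∀ i : Fin K, σ i < m + K := fun i => Nat.lt_add_right K (hσ i)
    exact .and (.forall_finite fun i => .forall_finite fun j =>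
        .or (.equal (hy i) (hy j)) (.adj (hy i) (hy j)))
      (.forall_finite fun i => .and (.not (.equal (hy i) (hx i))) (.not (.adj (hy i) (hx i))))
  refine ((h.exists_vertices K).not.mono (by omega)).congr fun n G ν => ?_
  rw [not_iff_comm, SimpleGraph.not_isCliqueTransversal_image_iff]
  constructor
  · rintro ⟨y, hc, hy⟩
    -- The tuple is placed in the variables from `m` on. The condition `m ≤ j` is needed because
    -- subtraction is truncated.
    refine ⟨fun j => if h : j - m < K ∧ m ≤ j then y ⟨j - m, h.1⟩ else ν j,
      fun i hi => dif_neg (by omega), ?_, ?_⟩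
    · intro i j
      simpa using hc i j
    · intro i
      have : ¬ m ≤ σ i := Nat.not_le.2 (hσ i)
      simpa [this] using hy i
  · rintro ⟨ν', hν, hc, hy⟩
    exact ⟨fun i => ν' (m + i), hc, fun i => by simpa [hν _ (hσ i)] using hy i⟩

/-- Bridges `Decides.exists_vertices`, which quantifies over assignments to all variables, and the
quantifiers over tuples in the combinatorial characterization. -/
theorem exists_agree_iff_tuple {n r : ℕ} {p : (Fin r → Fin n) → Prop} {m : ℕ} (ν : ℕ → Fin n) :
    (∃ ν' : ℕ → Fin n, (∀ i < m, ν' i = ν i) ∧ p fun i => ν' (m + i)) ↔ ∃ x, p x := by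
  constructor
  · rintro ⟨ν', -, h⟩
    exact ⟨_, h⟩
  · rintro ⟨x, h⟩
    refine ⟨fun j => if h : j - m < r ∧ m ≤ j then x ⟨j - m, h.1⟩ else ν j,
      fun i hi => dif_neg (by omega), ?_⟩
    simpa using h

/-- `τ_c⁺(G) > K` is decided by `3 * K` nested loops. -/
theorem decides_lt_upperCliqueTransversalNumber {K : ℕ} (hK : 1 ≤ K) :
    Decides 0 (3 * K) fun _ G _ => K + 1 ≤ G.upperCliqueTransversalNumber := by
  -- Variable `0` holds `v` and the next `K` variables a transversal avoiding its neighbours; the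
  -- universal quantifier is a negated search.
  have hA : Decides 0 (K + K + 1) fun n G ν => ∃ ν' : ℕ → Fin n, (∀ i < 0, ν' i = ν i) ∧
      ¬ ∃ ν'' : ℕ → Fin n, (∀ i < 0 + 1, ν'' i = ν' i) ∧
        (G.IsCliqueTransversal (Finset.univ.image fun i : Fin K => ν'' (0 + 1 + i)) ∧
          ∀ i : Fin K, ¬ G.Adj (ν'' 0) (ν'' (0 + 1 + i))) := by
    refine .exists_vertices 1 (.not (.exists_vertices K (.and ?_ ?_)))
    · exact decides_isCliqueTransversal (fun i : Fin K => 0 + 1 + i)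
        fun i => Nat.add_lt_add_left i.isLt _
    · exact (Decides.forall_finite fun i : Fin K => .not (.adj (by omega) (by omega))).mono
        (Nat.zero_le K)
  -- Variable numbers for the two guessed tuples, laid out consecutively.
  let ρ : Fin K ⊕ Fin K → ℕ := fun a => finSumFinEquiv a
  have hρ : ∀ a, ρ a < 0 + (K + K) := fun a => by
    rw [Nat.zero_add]
    exact (finSumFinEquiv a).isLt
  have hB : Decides 0 (K + (K + K)) fun n G ν => ∃ ν' : ℕ → Fin n, (∀ i < 0, ν' i = ν i) ∧
      (G.IsCliqueTransversal (Finset.univ.image fun i => ν' (ρ (.inl i))) ∧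
        G.IsCliqueTransversal (Finset.univ.image fun i => ν' (ρ (.inr i))) ∧
        ∃ i j : Fin K, ¬ G.Adj (ν' (ρ (.inl i))) (ν' (ρ (.inr j))) ∧
          (∀ l, ¬ ν' (ρ (.inr l)) = ν' (ρ (.inl i))) ∧
          (∀ l, ¬ ν' (ρ (.inl l)) = ν' (ρ (.inr j))) ∧
          ∀ e : Fin K → Fin K ⊕ Fin K,
            G.IsCliqueTransversal (Finset.univ.image fun l => ν' (ρ (e l))) →
            ∃ l, ν' (ρ (e l)) = ν' (ρ (.inl i)) ∨ ν' (ρ (e l)) = ν' (ρ (.inr j))) := by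
    have heq : ∀ a b, Decides (0 + (K + K)) K fun _ _ ν => ν (ρ a) = ν (ρ b) := fun a b =>
      (Decides.equal (hρ a) (hρ b)).mono (Nat.zero_le K)
    refine .exists_vertices (K + K) (.and (decides_isCliqueTransversal _ fun i => hρ _)
      (.and (decides_isCliqueTransversal _ fun i => hρ _)
      (.exists_finite fun i => .exists_finite fun j =>
        .and (.not ((Decides.adj (hρ _) (hρ _)).mono (Nat.zero_le K)))
        (.and (.forall_finite fun l => .not (heq _ _))
        (.and (.forall_finite fun l => .not (heq _ _))
        (.forall_finite fun e => .imp (decides_isCliqueTransversal _ fun l => hρ _)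
          (.exists_finite fun l => .or (heq _ _) (heq _ _))))))))
  -- Here `K ≥ 1` gives `2 * K + 1 ≤ 3 * K`.
  refine ((hA.mono (by omega)).or (hB.mono (by omega))).congr fun n G ν => ?_
  have : Nonempty (Fin n) := ⟨ν 0⟩
  rw [SimpleGraph.lt_upperCliqueTransversalNumber_iff hK]
  refine or_congr ⟨?_, ?_⟩ ⟨?_, ?_⟩
  · rintro ⟨ν', -, h⟩
    refine ⟨ν' 0, fun x hx => ?_⟩
    by_contra! hcon
    obtain ⟨ν'', hν, hp⟩ := (exists_agree_iff_tuple (m := 0 + 1) (p := fun x : Fin K → Fin n =>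
      G.IsCliqueTransversal (Finset.univ.image x) ∧ ∀ i, ¬ G.Adj (ν' 0) (x i)) ν').2 ⟨x, hx, hcon⟩
    exact h ⟨ν'', hν, hp.1, by rw [hν 0 (by omega)]; exact hp.2⟩
  · rintro ⟨v, hv⟩
    refine ⟨fun _ => v, by simp, ?_⟩
    rintro ⟨ν'', hν, hx, hadj⟩
    obtain ⟨i, hi⟩ := hv _ hx
    exact hadj i (by rwa [hν 0 (by omega)])
  · rintro ⟨ν', -, h⟩
    exact ⟨fun a => ν' (ρ a), h⟩
  · rintro ⟨w, h⟩
    refine ⟨fun j => if hj : j < K + K then w (finSumFinEquiv.symm ⟨j, hj⟩) else ν j, by simp, ?_⟩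
    have hw : ∀ a, (if hj : ρ a < K + K then w (finSumFinEquiv.symm ⟨ρ a, hj⟩) else ν (ρ a)) =
        w a := fun a => by
      rw [dif_pos (by simpa using hρ a)]
      simp [ρ]
    simp only [hw]
    exact h

end WordRAM

theorem mainTheorem2 (k : ℕ) (hk : 2 ≤ k) :
    GraphProblemSolvableInTime (KUpperCliqueTransversal k) (fun n => n ^ (3 * k - 3)) := by
  obtain ⟨K, rfl⟩ : ∃ K, k = K + 1 := ⟨k - 1, by omega⟩
  rw [show 3 * (K + 1) - 3 = 3 * K by omega]
  exact (WordRAM.decides_lt_upperCliqueTransversalNumber (by omega)).graphProblemSolvableInTime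
    (by omega) fun _ _ _ => Iff.rfl
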